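/- Let $\mathbb F_q$ be the finite field with $q$ elements and let $k\ge 2$. Call two polynomials $f,g\in\mathbb F_q[x_1,\dots,x_k]$ equivalent if $f=cg$ for some $c\in\mathbb F_q^\times$. For $\mathfrak m=(m_1,\dots,m_k)\in\mathbb Z_{\ge 0}^k$ let $N_k(\mathfrak m)$ be the number of equivalence classes of nonzero polynomials $f\in\mathbb F_q[x_1,\dots,x_k]$ of vector degree $(\deg_{x_1}f,\dots,\deg_{x_k}f)=\mathfrak m$, and let $I_k(\mathfrak m)$ be the number of those classes that consist of irreducible polynomials. Then there is a constant $C>0$, depending only on $q$ and $k$, such that for all positive integers $m_1,\dots,m_k$ with $m_1=\max_{1\le i\le k-1}m_i$, with $m_1\ge 3$ if $k=2$, and with $m_1\ge 2$ if $k=3$, $$\bigl|\,I_k(m_1,\dots,m_k)-N_k(m_1,\dots,m_k)+q\,N_k(m_1,\dots,m_{k-1},m_k-1)\,\bigr|\le C\,q^{\,m_1(m_2+1)\cdots(m_k+1)}.$$ -/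

import Mathlib

/-- The vector degree `(deg_{x_1} f, …, deg_{x_k} f)` of a polynomial in `k` variables
(meaningful for `f ≠ 0`; the variables are indexed by `0, …, k - 1`). -/
noncomputable def vectorDegree {F : Type*} [Field F] {k : ℕ} (f : MvPolynomial (Fin k) F) :
    Fin k → ℕ :=
  fun i => f.degreeOf i

/-- Normalized polynomials: `F[x_1, …, x_k]` modulo the relation `f ∼ g` iff `f = c g` for some
`c` in `Fˣ`. -/
abbrev NormalizedPoly (F : Type*) [Field F] (k : ℕ) :=
  MulAction.orbitRel.Quotient Fˣ (MvPolynomial (Fin k) F)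

/-- The class of a polynomial up to a nonzero constant factor. -/
noncomputable def NormalizedPoly.mk {F : Type*} [Field F] {k : ℕ} (f : MvPolynomial (Fin k) F) :
    NormalizedPoly F k :=
  Quotient.mk'' f

/-- The defining relation of `NormalizedPoly`, spelled out. -/
theorem NormalizedPoly.mk_eq_mk_iff {F : Type*} [Field F] {k : ℕ}
    (f g : MvPolynomial (Fin k) F) :
    NormalizedPoly.mk f = NormalizedPoly.mk g ↔ ∃ c : Fˣ, f = MvPolynomial.C (c : F) * g := by
  unfold NormalizedPoly.mk
  rw [Quotient.eq'']
  constructor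
  · rintro ⟨c, hc⟩
    exact ⟨c, by rw [← hc, ← MvPolynomial.smul_eq_C_mul]; rfl⟩
  · rintro ⟨c, hc⟩
    exact ⟨c, by rw [hc, ← MvPolynomial.smul_eq_C_mul]; rfl⟩

/-- The normalized (nonzero) polynomials over `F` of vector degree `m`. -/
def normalizedOfDegree (F : Type*) [Field F] {k : ℕ} (m : Fin k → ℕ) :
    Set (NormalizedPoly F k) :=
  {x | ∃ f : MvPolynomial (Fin k) F, f ≠ 0 ∧ vectorDegree f = m ∧ NormalizedPoly.mk f = x}

/-- The normalized irreducible polynomials over `F` of vector degree `m`. -/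
def irreducibleOfDegree (F : Type*) [Field F] {k : ℕ} (m : Fin k → ℕ) :
    Set (NormalizedPoly F k) :=
  {x | ∃ f : MvPolynomial (Fin k) F, Irreducible f ∧ vectorDegree f = m ∧
    NormalizedPoly.mk f = x}

/-- Over a finite field there are only finitely many normalized polynomials of a given vector
degree, so that the cardinalities below are honest ones. -/
theorem finite_normalizedOfDegree (F : Type*) [Field F] [Finite F] {k : ℕ} (m : Fin k → ℕ) :
    (normalizedOfDegree F m).Finite := by
  have hS : {s : Fin k →₀ ℕ | ∀ i, s i ≤ m i}.Finite := by
    refine Set.Finite.subset (Set.finite_Iic (Finsupp.equivFunOnFinite.symm m)) ?_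
    intro s hs i
    simpa using hs i
  have hfin : {f : MvPolynomial (Fin k) F | ∀ i, f.degreeOf i ≤ m i}.Finite := by
    have := hS.to_subtype
    refine Set.Finite.of_finite_image
      (f := fun f (s : {s : Fin k →₀ ℕ | ∀ i, s i ≤ m i}) => MvPolynomial.coeff s.1 f)
      (Set.toFinite _) ?_
    intro f hf g hg hfg
    ext s
    by_cases hs : ∀ i, s i ≤ m i
    · exact congrFun hfg ⟨s, hs⟩
    · push Not at hs
      obtain ⟨i, hi⟩ := hs
      have key : ∀ h : MvPolynomial (Fin k) F, h.degreeOf i ≤ m i →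
          MvPolynomial.coeff s h = 0 := by
        intro h hh
        by_contra hne
        have := MvPolynomial.monomial_le_degreeOf i (MvPolynomial.mem_support_iff.mpr hne)
        omega
      rw [key f (hf i), key g (hg i)]
  refine (hfin.image NormalizedPoly.mk).subset ?_
  rintro x ⟨f, -, hf, rfl⟩
  exact ⟨f, fun i => (congrFun hf i).le, rfl⟩

/-- An irreducible polynomial is nonzero. -/
theorem irreducibleOfDegree_subset (F : Type*) [Field F] {k : ℕ} (m : Fin k → ℕ) :
    irreducibleOfDegree F m ⊆ normalizedOfDegree F m := by
  rintro x ⟨f, hf, hm, rfl⟩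
  exact ⟨f, hf.ne_zero, hm, rfl⟩

/-- `N_k(m)`: the number of normalized polynomials of vector degree `m`. -/
noncomputable def numNormalized (F : Type*) [Field F] {k : ℕ} (m : Fin k → ℕ) : ℕ :=
  (normalizedOfDegree F m).ncard

/-- `I_k(m)`: the number of normalized irreducible polynomials of vector degree `m`. -/
noncomputable def numIrreducible (F : Type*) [Field F] {k : ℕ} (m : Fin k → ℕ) : ℕ :=
  (irreducibleOfDegree F m).ncard

/-!
Let `q` be the number of elements of `F`, and call a polynomial primitive if it has no nonconstant
divisor in `F[x_k]`. Every nonzero polynomial is uniquely the product of a monic polynomial `d` in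
`F[x_k]`, its content, and a primitive polynomial. Replacing the content `d` by `x_k d + c` with
`c ∈ F` is a bijection from pairs of an element of `F` and a polynomial of degree
`(m_1, …, m_k - 1)` to the non-primitive polynomials of degree `m`
(`ncard_not_isVarPrimitive`). So `N(m) - q N(m_1, …, m_k - 1)` is exactly the number of primitive
classes. Irreducible polynomials of degree `m` are primitive, and what has to be bounded is the
number of reducible primitive polynomials.

Such a polynomial is a product of two factors, of degrees `a` and `c = m - a`, each of which
involves a variable other than `x_k`. There are at most `q ^ E` pairs of factors, where
`E = ∏ (a_i + 1) + ∏ (c_i + 1)`. With `A`, `B` the two products restricted to `i < k`, and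
`T = m_1 (m_2 + 1) ⋯ (m_{k-1} + 1)`, one has `A + B ≤ T + 2`
(`prod_succ_add_prod_succ_le`) and `B ≤ T + 1 - ∑_{i < k} a_i` (`prod_succ_add_sum_le`), while the
assumptions on `m_1` give `T ≥ 3`. After swapping the factors so that `A ≤ B`, these combine to
`E ≤ T (m_k + 1) + 4 - ∑ a_i` (`exponent_le`). Summing over `a` leaves a geometric series in
each coordinate, hence the constant `q ^ 4 * 2 ^ k`.
-/

/-! ### Inequalities between products -/

theorem Finset.prod_add_sum_le_prod_add {ι : Type*} (s : Finset ι) (c b : ι → ℕ)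
    (hc : ∀ i ∈ s, 1 ≤ c i) : ∏ i ∈ s, c i + ∑ i ∈ s, b i ≤ ∏ i ∈ s, (c i + b i) := by
  classical
  induction s using Finset.induction_on with
  | empty => simp
  | insert i s hi ih =>
    rw [Finset.prod_insert hi, Finset.sum_insert hi, Finset.prod_insert hi]
    have h1 := ih fun j hj => hc j (Finset.mem_insert_of_mem hj)
    have h2 := hc i (Finset.mem_insert_self i s)
    have h3 : 1 ≤ ∏ j ∈ s, c j :=
      Finset.one_le_prod' fun j hj => hc j (Finset.mem_insert_of_mem hj)
    nlinarith [Nat.mul_le_mul_left (c i + b i) h1, Nat.mul_le_mul_left (b i) h3,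
      Nat.mul_le_mul_right (∑ j ∈ s, b j) h2, Nat.zero_le (b i * ∑ j ∈ s, b j)]

theorem Finset.prod_succ_add_prod_succ_le {ι : Type*} (s : Finset ι) (a c : ι → ℕ) :
    ∏ i ∈ s, (a i + 1) + ∏ i ∈ s, (c i + 1) ≤ ∏ i ∈ s, (a i + c i + 1) + 1 := by
  classical
  induction s using Finset.induction_on with
  | empty => simp
  | insert i s hi ih =>
    simp only [Finset.prod_insert hi]
    have hX : 1 ≤ ∏ j ∈ s, (a j + 1) := Finset.one_le_prod' fun j _ => by omega
    have hY : 1 ≤ ∏ j ∈ s, (c j + 1) := Finset.one_le_prod' fun j _ => by omega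
    nlinarith [Nat.mul_le_mul_left (a i + c i + 1) ih, Nat.mul_le_mul_left (a i) hY,
      Nat.mul_le_mul_left (c i) hX]

/-- The product with one factor `m i + 1` lowered to `m i` is largest when `m i` is maximal. -/
theorem Finset.mul_prod_erase_succ_le {ι : Type*} [DecidableEq ι] {s : Finset ι} {m : ι → ℕ}
    {o i : ι} (ho : o ∈ s) (hi : i ∈ s) (h : m i ≤ m o) :
    m i * ∏ j ∈ s.erase i, (m j + 1) ≤ m o * ∏ j ∈ s.erase o, (m j + 1) := by
  have h1 := Finset.mul_prod_erase s (fun j => m j + 1) ho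
  have h2 := Finset.mul_prod_erase s (fun j => m j + 1) hi
  rw [← h2] at h1
  by_contra! hlt
  have : ∏ j ∈ s.erase i, (m j + 1) < ∏ j ∈ s.erase o, (m j + 1) := by
    rw [add_mul, add_mul] at h1
    omega
  nlinarith [Nat.mul_le_mul h this.le]

/-- If `a ≠ 0`, then `∏ (c i + 1)` falls short of the extremal product by at least
`∑ a i - 1`. -/
theorem prod_succ_add_sum_le {ι : Type*} [DecidableEq ι] {s : Finset ι} {a c : ι → ℕ} {o : ι}
    (ho : o ∈ s) (hmax : ∀ i ∈ s, a i + c i ≤ a o + c o) (ha : ∃ i ∈ s, 1 ≤ a i) :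
    ∏ i ∈ s, (c i + 1) + ∑ i ∈ s, a i ≤
      (a o + c o) * ∏ i ∈ s.erase o, (a i + c i + 1) + 1 := by
  obtain ⟨i, hi, hai⟩ := ha
  have hT := Finset.mul_prod_erase_succ_le (m := fun j => a j + c j) ho hi (hmax i hi)
  have h := Finset.prod_add_sum_le_prod_add s (fun j => c j + 1)
    (Function.update a i (a i - 1)) (fun _ _ => by omega)
  rw [← Finset.mul_prod_erase s (fun j => c j + 1 + Function.update a i (a i - 1) j) hi,
    ← Finset.add_sum_erase s (Function.update a i (a i - 1)) hi] at h
  have e1 : ∏ j ∈ s.erase i, (c j + 1 + Function.update a i (a i - 1) j) =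
      ∏ j ∈ s.erase i, (a j + c j + 1) := Finset.prod_congr rfl fun j hj => by
    rw [Function.update_of_ne (Finset.ne_of_mem_erase hj)]; ring
  have e2 : ∑ j ∈ s.erase i, Function.update a i (a i - 1) j = ∑ j ∈ s.erase i, a j :=
    Finset.sum_congr rfl fun j hj => Function.update_of_ne (Finset.ne_of_mem_erase hj) _ _
  rw [e1, e2, Function.update_self,
    show c i + 1 + (a i - 1) = a i + c i by omega] at h
  rw [← Finset.add_sum_erase s a hi]
  omega

/-- Two nonzero summands `a`, `c` of `m`: the sum of the two products is largest when one summand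
is a unit vector in a direction where `m` is maximal. -/
theorem prod_succ_add_prod_succ_le {ι : Type*} [DecidableEq ι] {s : Finset ι} {a c : ι → ℕ}
    {o : ι} (ho : o ∈ s) (hmax : ∀ i ∈ s, a i + c i ≤ a o + c o)
    (ha : ∃ i ∈ s, 1 ≤ a i) (hc : ∃ i ∈ s, 1 ≤ c i) :
    ∏ i ∈ s, (a i + 1) + ∏ i ∈ s, (c i + 1) ≤
      (a o + c o) * ∏ i ∈ s.erase o, (a i + c i + 1) + 2 := by
  by_cases hboth : ∃ i ∈ s, 1 ≤ a i ∧ 1 ≤ c i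
  · obtain ⟨i, hi, hai, hci⟩ := hboth
    have hT := Finset.mul_prod_erase_succ_le (m := fun j => a j + c j) ho hi (hmax i hi)
    refine le_trans ?_ (Nat.add_le_add_right hT 2)
    rw [← Finset.mul_prod_erase s (fun j => a j + 1) hi,
      ← Finset.mul_prod_erase s (fun j => c j + 1) hi]
    have h := Finset.prod_succ_add_prod_succ_le (s.erase i) a c
    have hX : 1 ≤ ∏ j ∈ s.erase i, (a j + 1) := Finset.one_le_prod' fun j _ => by omega
    have hY : 1 ≤ ∏ j ∈ s.erase i, (c j + 1) := Finset.one_le_prod' fun j _ => by omega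
    generalize ∏ j ∈ s.erase i, (a j + 1) = X at *
    generalize ∏ j ∈ s.erase i, (c j + 1) = Y at *
    generalize ∏ j ∈ s.erase i, (a j + c j + 1) = R at *
    obtain ⟨a', ha'⟩ := Nat.exists_eq_add_of_le hai
    obtain ⟨c', hc'⟩ := Nat.exists_eq_add_of_le hci
    obtain ⟨x, rfl⟩ := Nat.exists_eq_add_of_le hX
    obtain ⟨y, rfl⟩ := Nat.exists_eq_add_of_le hY
    rw [ha', hc']
    have : 1 + x + y ≤ R := by omega
    nlinarith [Nat.mul_le_mul_left (1 + a' + (1 + c')) this, Nat.zero_le (a' * y),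
      Nat.zero_le (c' * x)]
  · push Not at hboth
    obtain ⟨i, hi, hai⟩ := ha
    obtain ⟨l, hl, hcl⟩ := hc
    have hci : c i = 0 := by have := hboth i hi hai; omega
    have hal : a l = 0 := by by_contra h; have := hboth l hl (by omega); omega
    have hil : l ≠ i := by rintro rfl; omega
    have hl' : l ∈ s.erase i := Finset.mem_erase.2 ⟨hil, hl⟩
    have hT := Finset.mul_prod_erase_succ_le (m := fun j => a j + c j) ho hi (hmax i hi)
    refine le_trans ?_ (Nat.add_le_add_right hT 2)
    rw [← Finset.mul_prod_erase s (fun j => a j + 1) hi,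
      ← Finset.mul_prod_erase s (fun j => c j + 1) hi,
      ← Finset.mul_prod_erase (s.erase i) (fun j => a j + 1) hl',
      ← Finset.mul_prod_erase (s.erase i) (fun j => c j + 1) hl',
      ← Finset.mul_prod_erase (s.erase i) (fun j => a j + c j + 1) hl']
    have h := Finset.prod_succ_add_prod_succ_le ((s.erase i).erase l) a c
    have hX : 1 ≤ ∏ j ∈ (s.erase i).erase l, (a j + 1) :=
      Finset.one_le_prod' fun j _ => by omega
    have hY : 1 ≤ ∏ j ∈ (s.erase i).erase l, (c j + 1) :=
      Finset.one_le_prod' fun j _ => by omega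
    simp only [hci, hal, zero_add, add_zero, one_mul]
    generalize ∏ j ∈ (s.erase i).erase l, (a j + 1) = X at *
    generalize ∏ j ∈ (s.erase i).erase l, (c j + 1) = Y at *
    generalize ∏ j ∈ (s.erase i).erase l, (a j + c j + 1) = R at *
    obtain ⟨a', ha'⟩ := Nat.exists_eq_add_of_le hai
    obtain ⟨c', hc'⟩ := Nat.exists_eq_add_of_le hcl
    obtain ⟨x, rfl⟩ := Nat.exists_eq_add_of_le hX
    obtain ⟨y, rfl⟩ := Nat.exists_eq_add_of_le hY
    rw [ha', hc']
    have : 1 + x + y ≤ R := by omega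
    have h2 := Nat.mul_le_mul_left ((1 + a') * (1 + c' + 1)) this
    rw [mul_assoc _ _ R] at h2
    refine le_trans ?_ (Nat.add_le_add_right h2 2)
    ring_nf
    nlinarith [Nat.zero_le (a' * c'), Nat.zero_le (a' * c' * x), Nat.zero_le (a' * c' * y),
      Nat.zero_le (c' * x), Nat.zero_le (a' * y), Nat.zero_le (a' * x), Nat.zero_le (c' * y)]

/-- The exponent bound for one way of splitting, in terms of the products `A ≤ B` over all but
the last variable, the degrees `v`, `w` in the last variable, and the extremal product `T`. -/
theorem exponent_arith {A B S T v w : ℕ} (hAB : A ≤ B) (h1 : A + B ≤ T + 2)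
    (h2 : B + S ≤ T + 1) (hS : 1 ≤ S) (hT : 3 ≤ T) (hvw : 1 ≤ v + w) :
    A * (v + 1) + B * (w + 1) + (S + v) ≤ T * (v + w + 1) + 4 := by
  obtain ⟨d, rfl⟩ : ∃ d, T = B + d := Nat.exists_eq_add_of_le (by omega)
  obtain ⟨n, hn⟩ : ∃ n, v + w = 1 + n := Nat.exists_eq_add_of_le hvw
  rcases hAB.eq_or_lt with rfl | hlt
  · -- here the sum over `v` is not geometric, and `T > B` compensates
    obtain ⟨e, rfl⟩ : ∃ e, d = 1 + e := Nat.exists_eq_add_of_le (by omega)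
    nlinarith [Nat.zero_le (n * e), congrArg (A * ·) hn, congrArg ((1 + e) * ·) hn]
  · obtain ⟨e, rfl⟩ : ∃ e, B = A + 1 + e := Nat.exists_eq_add_of_le hlt
    nlinarith [Nat.zero_le (n * d), Nat.zero_le (e * v), congrArg (d * ·) hn]

/-- The exponent bound: the degrees `a`, `c` of two factors of a polynomial of degree `a + c`
satisfy `∏ (a i + 1) + ∏ (c i + 1) ≤ D + 4 - ∑ a i`, where `q ^ D` is the error term. -/
theorem exponent_le {ι : Type*} [Fintype ι] [DecidableEq ι] {a c : ι → ℕ} {o l : ι}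
    (hol : o ≠ l) (hmax : ∀ i, i ≠ l → a i + c i ≤ a o + c o)
    (ha : ∃ i, i ≠ l ∧ 1 ≤ a i) (hc : ∃ i, i ≠ l ∧ 1 ≤ c i) (hl : 1 ≤ a l + c l)
    (hAB : ∏ i ∈ Finset.univ.erase l, (a i + 1) ≤ ∏ i ∈ Finset.univ.erase l, (c i + 1))
    (hT : 3 ≤ (a o + c o) * ∏ i ∈ (Finset.univ.erase l).erase o, (a i + c i + 1)) :
    ∏ i, (a i + 1) + ∏ i, (c i + 1) + ∑ i, a i ≤
      (a o + c o) * ∏ i ∈ Finset.univ.erase o, (a i + c i + 1) + 4 := by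
  have ho : o ∈ Finset.univ.erase l := by simp [hol]
  have hl' : l ∈ Finset.univ.erase o := by simp [hol.symm]
  have hmax' : ∀ i ∈ Finset.univ.erase l, a i + c i ≤ a o + c o :=
    fun i hi => hmax i (Finset.ne_of_mem_erase hi)
  have ha' : ∃ i ∈ Finset.univ.erase l, 1 ≤ a i := by simpa using ha
  have hc' : ∃ i ∈ Finset.univ.erase l, 1 ≤ c i := by simpa using hc
  have h1 := prod_succ_add_prod_succ_le ho hmax' ha' hc'
  have h2 := prod_succ_add_sum_le ho hmax' ha'
  have hS : 1 ≤ ∑ i ∈ Finset.univ.erase l, a i := by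
    obtain ⟨i, hi, h⟩ := ha'
    exact h.trans (Finset.single_le_sum (f := a) (fun _ _ => Nat.zero_le _) hi)
  have h := exponent_arith hAB h1 h2 hS hT hl
  rw [← Finset.prod_erase_mul Finset.univ (fun i => a i + 1) (Finset.mem_univ l),
    ← Finset.prod_erase_mul Finset.univ (fun i => c i + 1) (Finset.mem_univ l),
    ← Finset.sum_erase_add Finset.univ a (Finset.mem_univ l),
    ← Finset.prod_erase_mul (Finset.univ.erase o) (fun i => a i + c i + 1) hl',
    Finset.erase_right_comm, ← mul_assoc]
  exact h

/-- A geometric sum over a box is bounded independently of the box. -/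
theorem sum_inv_pow_le {ι : Type*} [Fintype ι] [DecidableEq ι] {q : ℝ} (hq : 2 ≤ q)
    (m : ι → ℕ) :
    ∑ a ∈ Fintype.piFinset fun i => Finset.range (m i + 1), (q⁻¹) ^ (∑ i, a i) ≤
      2 ^ Fintype.card ι := by
  have hq0 : (0 : ℝ) < q := by linarith
  have hq1 : q⁻¹ ≤ 2⁻¹ := inv_anti₀ two_pos hq
  simp_rw [← Finset.prod_pow_eq_pow_sum]
  rw [← Finset.prod_univ_sum (fun i => Finset.range (m i + 1)) fun _ j => q⁻¹ ^ j]
  refine (Finset.prod_le_prod (fun i _ => Finset.sum_nonneg fun j _ => by positivity)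
    (g := fun _ => 2) fun i _ => ?_).trans_eq (by simp)
  rw [Finset.range_eq_Ico]
  refine (geom_sum_Ico_le_of_lt_one (by positivity) (by linarith)).trans ?_
  rw [pow_zero, div_le_iff₀ (by linarith)]
  linarith

/-! ### Polynomials in a single variable inside `MvPolynomial` -/

section OneVariable

variable {F : Type*} [Field F] {σ : Type*}

/-- The embedding `F[X] → F[x_i : i ∈ σ]` sending `X` to the variable `x_j`. -/
noncomputable abbrev inVar (j : σ) : Polynomial F →ₐ[F] MvPolynomial σ F :=
  Polynomial.aeval (MvPolynomial.X j)

theorem coeff_inVar [DecidableEq σ] (j : σ) (u : Polynomial F) (s : σ →₀ ℕ) :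
    (inVar j u).coeff s = if s = Finsupp.single j (s j) then u.coeff (s j) else 0 := by
  induction u using Polynomial.induction_on' with
  | add p q hp hq => rw [map_add, MvPolynomial.coeff_add, hp, hq]; split_ifs <;> simp
  | monomial n a =>
    have : inVar j (Polynomial.monomial n a) =
        MvPolynomial.monomial (Finsupp.single j n) a := by
      rw [Polynomial.aeval_monomial, MvPolynomial.algebraMap_eq,
        MvPolynomial.X_pow_eq_monomial, MvPolynomial.C_mul_monomial, mul_one]
    rw [this, MvPolynomial.coeff_monomial, Polynomial.coeff_monomial]
    by_cases h : Finsupp.single j n = s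
    · subst h; simp
    · rw [if_neg h]
      split_ifs with h1 h2
      · exact absurd (h2 ▸ h1.symm) h
      · rfl
      · rfl

theorem inVar_injective (j : σ) : Function.Injective (inVar (F := F) j) := by
  classical
  intro u v h
  ext n
  simpa [coeff_inVar] using congrArg (MvPolynomial.coeff (Finsupp.single j n)) h

theorem inVar_ne_zero (j : σ) {u : Polynomial F} (hu : u ≠ 0) : inVar j u ≠ 0 :=
  (map_ne_zero_iff _ (inVar_injective j)).2 hu

theorem degreeOf_inVar_self (j : σ) (u : Polynomial F) :
    (inVar j u).degreeOf j = u.natDegree := by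
  classical
  apply le_antisymm
  · rw [MvPolynomial.degreeOf_le_iff]
    intro s hs
    rw [MvPolynomial.mem_support_iff, coeff_inVar] at hs
    exact Polynomial.le_natDegree_of_ne_zero fun h => hs (by simp [h])
  · rcases eq_or_ne u 0 with rfl | hu
    · simp
    · have : Finsupp.single j u.natDegree ∈ (inVar j u).support := by
        rw [MvPolynomial.mem_support_iff, coeff_inVar]
        simpa using hu
      simpa using MvPolynomial.le_degreeOf_of_mem_support j this

theorem degreeOf_inVar_of_ne {i j : σ} (h : i ≠ j) (u : Polynomial F) :
    (inVar j u).degreeOf i = 0 := by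
  classical
  rw [← Nat.le_zero, MvPolynomial.degreeOf_le_iff]
  intro s hs
  rw [MvPolynomial.mem_support_iff, coeff_inVar] at hs
  have : s = Finsupp.single j (s j) := by by_contra h'; simp [h'] at hs
  rw [this, Finsupp.single_eq_of_ne h]

theorem exists_inVar_eq {j : σ} {f : MvPolynomial σ F} (h : ∀ i, i ≠ j → f.degreeOf i = 0) :
    ∃ u, inVar j u = f := by
  have : f ∈ MvPolynomial.supported F {j} := by
    rw [MvPolynomial.mem_supported]
    intro i hi
    by_contra hij
    exact MvPolynomial.mem_vars_iff_degreeOf_ne_zero.1 hi (h i hij)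
  rw [MvPolynomial.supported_eq_adjoin_X, Set.image_singleton,
    Algebra.adjoin_singleton_eq_range_aeval] at this
  exact this

/-! ### Primitive polynomials with respect to a variable -/

/-- A polynomial is primitive with respect to `x_j` if all its divisors in `F[x_j]` are
constants. (Zero is not primitive.) -/
def IsVarPrimitive (j : σ) (f : MvPolynomial σ F) : Prop :=
  ∀ u : Polynomial F, inVar j u ∣ f → IsUnit u

theorem IsVarPrimitive.ne_zero {j : σ} {f : MvPolynomial σ F} (hf : IsVarPrimitive j f) :
    f ≠ 0 := by
  rintro rfl
  exact not_isUnit_zero (hf 0 (dvd_zero _))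

theorem isUnit_of_natDegree_eq_zero {u : Polynomial F} (hu : u ≠ 0) (h : u.natDegree = 0) :
    IsUnit u := by
  rw [Polynomial.isUnit_iff_degree_eq_zero, Polynomial.degree_eq_natDegree hu, h, Nat.cast_zero]

/-- Every nonzero polynomial is the product of its content in `F[x_j]`, a monic polynomial, and a
primitive polynomial: take a divisor in `F[x_j]` of largest degree. -/
theorem exists_content_mul_primitive (j : σ) {f : MvPolynomial σ F} (hf : f ≠ 0) :
    ∃ (d : Polynomial F) (p : MvPolynomial σ F),
      d.Monic ∧ IsVarPrimitive j p ∧ inVar j d * p = f := by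
  have hdeg : ∀ u : Polynomial F, inVar j u ∣ f → u.natDegree ≤ f.degreeOf j := by
    rintro u ⟨w, rfl⟩
    rw [MvPolynomial.degreeOf_mul_eq (left_ne_zero_of_mul hf) (right_ne_zero_of_mul hf),
      degreeOf_inVar_self]
    exact Nat.le_add_right _ _
  classical
  let P : ℕ → Prop := fun n => ∃ u : Polynomial F, u.Monic ∧ inVar j u ∣ f ∧ u.natDegree = n
  have h0 : P 0 := ⟨1, Polynomial.monic_one, by simp, by simp⟩
  obtain ⟨d, hd, ⟨p, hp⟩, hdn⟩ := Nat.findGreatest_spec (Nat.zero_le (f.degreeOf j)) h0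
  refine ⟨d, p, hd, ?_, hp.symm⟩
  intro u hu
  have hp0 : p ≠ 0 := by rintro rfl; simp at hp; exact hf hp
  have hu0 : u ≠ 0 := by
    rintro rfl
    rw [map_zero, zero_dvd_iff] at hu
    exact hp0 hu
  let v := u * Polynomial.C u.leadingCoeff⁻¹
  have hv : v.Monic := Polynomial.monic_mul_leadingCoeff_inv hu0
  have hvu : v.natDegree = u.natDegree := Polynomial.natDegree_mul_leadingCoeff_inv u hu0
  have hvp : inVar j v ∣ p := by
    refine dvd_trans (map_dvd _ (Associated.dvd ?_)) hu
    refine associated_mul_unit_left u _ ?_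
    simpa using hu0
  have hdv : inVar j (d * v) ∣ f := by
    rw [hp, map_mul]
    exact mul_dvd_mul_left _ hvp
  have := Nat.le_findGreatest (P := P) (hdeg _ hdv) ⟨_, hd.mul hv, hdv, rfl⟩
  rw [hd.natDegree_mul hv] at this
  exact isUnit_of_natDegree_eq_zero hu0 (by omega)

/-- The content and the primitive part are unique: after cancelling the greatest common divisor
of the contents, each content divides the other primitive part by Bézout. -/
theorem content_unique {j : σ} {d e : Polynomial F} {p r : MvPolynomial σ F} (hd : d.Monic)
    (he : e.Monic) (hp : IsVarPrimitive j p) (hr : IsVarPrimitive j r)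
    (h : inVar j d * p = inVar j e * r) : d = e ∧ p = r := by
  classical
  have key : ∀ {a b : Polynomial F} {p r : MvPolynomial σ F}, IsCoprime a b →
      IsVarPrimitive j r → inVar j a * p = inVar j b * r → IsUnit a := by
    intro a b p r hab hr h
    exact hr a ((hab.map (inVar j).toRingHom).dvd_of_dvd_mul_left ⟨p, h.symm⟩)
  obtain ⟨a, b, hab, hda, heb⟩ : ∃ a b, IsCoprime a b ∧ d = EuclideanDomain.gcd d e * a ∧
      e = EuclideanDomain.gcd d e * b := by
    have hg : EuclideanDomain.gcd d e ≠ 0 := fun h0 =>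
      hd.ne_zero (EuclideanDomain.gcd_eq_zero_iff.1 h0).1
    obtain ⟨a, ha⟩ := EuclideanDomain.gcd_dvd_left d e
    obtain ⟨b, hb⟩ := EuclideanDomain.gcd_dvd_right d e
    refine ⟨a, b, ⟨EuclideanDomain.gcdA d e, EuclideanDomain.gcdB d e, ?_⟩, ha, hb⟩
    apply mul_left_cancel₀ hg
    have hbez := EuclideanDomain.gcd_eq_gcd_ab d e
    calc _ = (EuclideanDomain.gcd d e * a) * EuclideanDomain.gcdA d e +
          (EuclideanDomain.gcd d e * b) * EuclideanDomain.gcdB d e := by ring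
      _ = _ := by rw [← ha, ← hb, mul_one, ← hbez]
  generalize EuclideanDomain.gcd d e = g at *
  have hg : inVar j g ≠ 0 := inVar_ne_zero j fun h0 => hd.ne_zero (by rw [hda, h0, zero_mul])
  have hcancel : inVar j a * p = inVar j b * r := by
    apply mul_left_cancel₀ hg
    rw [← mul_assoc, ← mul_assoc, ← map_mul, ← map_mul, ← hda, ← heb, h]
  have ha : IsUnit a := key hab hr hcancel
  have hb : IsUnit b := key hab.symm hp hcancel.symm
  have hde : d = e := by
    apply Polynomial.eq_of_monic_of_associated hd he
    rw [hda, heb]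
    exact ((associated_mul_unit_left g a ha)).trans (associated_mul_unit_left g b hb).symm
  subst hde
  exact ⟨rfl, mul_left_cancel₀ (inVar_ne_zero j hd.ne_zero) h⟩

theorem Irreducible.isVarPrimitive {i j : σ} (hij : i ≠ j) {f : MvPolynomial σ F}
    (hf : Irreducible f) (hi : 0 < f.degreeOf i) : IsVarPrimitive j f := by
  rintro u ⟨w, hw⟩
  rcases hf.isUnit_or_isUnit hw with h | h
  · have h0 : u.natDegree = 0 := by
      obtain ⟨r, -, hr⟩ := MvPolynomial.isUnit_iff_eq_C_of_isReduced.1 h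
      rw [← degreeOf_inVar_self j u, hr, MvPolynomial.degreeOf_C]
    have hu : u ≠ 0 := by rintro rfl; simp at h
    exact isUnit_of_natDegree_eq_zero hu h0
  · obtain ⟨r, -, rfl⟩ := MvPolynomial.isUnit_iff_eq_C_of_isReduced.1 h
    have := MvPolynomial.degreeOf_mul_le i (inVar j u) (MvPolynomial.C r)
    rw [← hw, degreeOf_inVar_of_ne hij, MvPolynomial.degreeOf_C] at this
    omega

/-- A factor of a primitive polynomial that is not a unit involves a variable other than
`x_j`. -/
theorem IsVarPrimitive.exists_degreeOf_pos {j : σ} {f g : MvPolynomial σ F}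
    (hf : IsVarPrimitive j f) (hg : g ∣ f) (hu : ¬ IsUnit g) :
    ∃ i, i ≠ j ∧ 1 ≤ g.degreeOf i := by
  by_contra! h
  obtain ⟨u, rfl⟩ := exists_inVar_eq (j := j) (f := g) fun i hi => by have := h i hi; omega
  exact hu ((hf u hg).map _)

end OneVariable

/-! ### Counting polynomials of given degrees -/

section Counting

variable {F : Type*} [Field F] {σ : Type*}

variable (F) in
/-- The nonzero polynomials of vector degree `m`, not taken up to constant factors. -/
def degreeSet (m : σ → ℕ) : Set (MvPolynomial σ F) :=
  {f | f ≠ 0 ∧ ∀ i, f.degreeOf i = m i}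

variable (F) in
/-- The polynomials, zero included, whose degree in each `x_i` is at most `m i`. -/
def degreeBox (m : σ → ℕ) : Set (MvPolynomial σ F) :=
  {f | ∀ i, f.degreeOf i ≤ m i}

theorem degreeSet_subset_degreeBox (m : σ → ℕ) : degreeSet F m ⊆ degreeBox F m :=
  fun _ hf i => (hf.2 i).le

/-- A polynomial in a box is determined by its coefficients at the exponents in that box. -/
theorem injOn_coeff_degreeBox [Finite σ] (m : σ → ℕ) :
    Set.InjOn (fun (f : MvPolynomial σ F) (t : ∀ i, Fin (m i + 1)) =>
      f.coeff (Finsupp.equivFunOnFinite.symm fun i => (t i : ℕ))) (degreeBox F m) := by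
  intro f hf g hg hfg
  ext s
  by_cases hs : ∀ i, s i ≤ m i
  · have := congrFun hfg fun i => ⟨s i, Nat.lt_succ_of_le (hs i)⟩
    simpa using this
  · push Not at hs
    obtain ⟨i, hi⟩ := hs
    rw [MvPolynomial.notMem_support_iff.1
        (MvPolynomial.notMem_support_of_degreeOf_lt i ((hf i).trans_lt hi)),
      MvPolynomial.notMem_support_iff.1
        (MvPolynomial.notMem_support_of_degreeOf_lt i ((hg i).trans_lt hi))]

theorem finite_degreeBox [Finite F] [Finite σ] (m : σ → ℕ) : (degreeBox F m).Finite :=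
  Set.Finite.of_finite_image (Set.toFinite _) (injOn_coeff_degreeBox m)

theorem finite_degreeSet [Finite F] [Finite σ] (m : σ → ℕ) : (degreeSet F m).Finite :=
  (finite_degreeBox m).subset (degreeSet_subset_degreeBox m)

theorem ncard_degreeBox_le [Finite F] [Fintype σ] (m : σ → ℕ) :
    (degreeBox F m).ncard ≤ Nat.card F ^ ∏ i, (m i + 1) := by
  refine (Set.ncard_le_ncard_of_injOn (t := Set.univ) _ (fun _ _ => Set.mem_univ _)
    (injOn_coeff_degreeBox m)).trans_eq ?_
  rw [Set.ncard_univ, Nat.card_fun, Nat.card_pi]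
  simp

theorem degreeOf_inVar_mul [DecidableEq σ] {j i : σ} {u : Polynomial F} {p : MvPolynomial σ F}
    (hu : u ≠ 0) (hp : p ≠ 0) :
    (inVar j u * p).degreeOf i = (if i = j then u.natDegree else 0) + p.degreeOf i := by
  rw [MvPolynomial.degreeOf_mul_eq (inVar_ne_zero j hu) hp]
  split_ifs with h
  · rw [h, degreeOf_inVar_self]
  · rw [degreeOf_inVar_of_ne h]

theorem monic_X_mul_add_C {d : Polynomial F} (hd : d.Monic) (c : F) :
    (Polynomial.X * d + Polynomial.C c).Monic ∧
      (Polynomial.X * d + Polynomial.C c).natDegree = d.natDegree + 1 := by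
  have hdeg : (Polynomial.X * d).natDegree = d.natDegree + 1 := by
    rw [Polynomial.natDegree_X_mul hd.ne_zero]
  constructor
  · apply (Polynomial.monic_X.mul hd).add_of_left
    apply Polynomial.degree_lt_degree
    rw [hdeg, Polynomial.natDegree_C]
    exact Nat.succ_pos _
  · rw [Polynomial.natDegree_add_C, hdeg]

theorem X_mul_add_C_inj {d e : Polynomial F} {a b : F}
    (h : Polynomial.X * d + Polynomial.C a = Polynomial.X * e + Polynomial.C b) :
    d = e ∧ a = b := by
  have hab : a = b := by simpa using congrArg (Polynomial.coeff · 0) h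
  subst hab
  exact ⟨mul_left_cancel₀ Polynomial.X_ne_zero (add_right_cancel h), rfl⟩

/-- The polynomials of degree `m` that are not primitive in `x_j` are `q` times as many as the
polynomials of degree `m - e_j`: replacing the content `d` by `X d + c`, with `c` in `F`, is a
bijection. -/
theorem ncard_not_isVarPrimitive [Finite F] [Finite σ] [DecidableEq σ] (j : σ) (m : σ → ℕ)
    (hm : 0 < m j) :
    {f | f ∈ degreeSet F m ∧ ¬ IsVarPrimitive j f}.ncard =
      Nat.card F * (degreeSet F (Function.update m j (m j - 1))).ncard := by
  choose d p hd hp hdp using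
    fun (f : MvPolynomial σ F) (hf : f ≠ 0) => exists_content_mul_primitive j hf
  rw [← Set.ncard_univ, ← Set.ncard_prod]
  symm
  refine Set.ncard_congr
    (fun (a : F × MvPolynomial σ F) ha =>
      inVar j (Polynomial.X * d a.2 ha.2.1 + Polynomial.C a.1) * p a.2 ha.2.1) ?_ ?_ ?_
  · rintro ⟨c, f⟩ ⟨-, hf⟩
    obtain ⟨hmon, hnat⟩ := monic_X_mul_add_C (hd f hf.1) c
    have hp0 := (hp f hf.1).ne_zero
    refine ⟨⟨mul_ne_zero (inVar_ne_zero j hmon.ne_zero) hp0, fun i => ?_⟩, fun hprim => ?_⟩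
    · have h1 := hf.2 i
      rw [← hdp f hf.1, degreeOf_inVar_mul (hd f hf.1).ne_zero hp0] at h1
      dsimp only at h1 hnat hp0 ⊢
      rw [degreeOf_inVar_mul hmon.ne_zero hp0, hnat]
      rcases eq_or_ne i j with rfl | hij
      · rw [Function.update_self] at h1
        simp only [if_true] at h1 ⊢
        omega
      · rw [Function.update_of_ne hij] at h1
        simpa [hij] using h1
    · have := Polynomial.natDegree_eq_zero_of_isUnit (hprim _ (dvd_mul_right _ _))
      exact absurd (hnat.symm.trans this) (Nat.succ_ne_zero _)
  · rintro ⟨a, f⟩ ⟨b, g⟩ ⟨ha, hf⟩ ⟨hb, hg⟩ h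
    obtain ⟨h1, h2⟩ := content_unique (monic_X_mul_add_C (hd f hf.1) a).1
      (monic_X_mul_add_C (hd g hg.1) b).1 (hp f hf.1) (hp g hg.1) h
    obtain ⟨h3, rfl⟩ := X_mul_add_C_inj h1
    have hfg : f = g := by rw [← hdp f hf.1, ← hdp g hg.1, h2, h3]
    rw [hfg]
  · rintro g ⟨hg, hprim⟩
    have hp0 := (hp g hg.1).ne_zero
    generalize he : d g hg.1 = e
    have hmon : e.Monic := he ▸ hd g hg.1
    have heg : inVar j e * p g hg.1 = g := he ▸ hdp g hg.1
    have hdeg : 0 < e.natDegree := by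
      by_contra h
      rw [hmon.natDegree_eq_zero.1 (by omega), map_one, one_mul] at heg
      exact hprim (heg ▸ hp g hg.1)
    have hnat := Polynomial.natDegree_divX_eq_natDegree_tsub_one (p := e)
    have hdivX : e.divX.Monic := by
      rw [Polynomial.Monic, Polynomial.leadingCoeff, Polynomial.coeff_divX, hnat,
        Nat.sub_add_cancel hdeg]
      exact hmon
    have hf : inVar j e.divX * p g hg.1 ∈ degreeSet F (Function.update m j (m j - 1)) := by
      refine ⟨mul_ne_zero (inVar_ne_zero j hdivX.ne_zero) hp0, fun i => ?_⟩
      have h1 := hg.2 i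
      rw [← heg, degreeOf_inVar_mul hmon.ne_zero hp0] at h1
      rw [degreeOf_inVar_mul hdivX.ne_zero hp0, hnat]
      rcases eq_or_ne i j with rfl | hij
      · rw [Function.update_self]
        simp only [if_true] at h1 ⊢
        omega
      · rw [Function.update_of_ne hij]
        simpa [hij] using h1
    obtain ⟨h1, h2⟩ := content_unique (hd _ hf.1) hdivX (hp _ hf.1) (hp g hg.1) (hdp _ hf.1)
    refine ⟨(e.coeff 0, inVar j e.divX * p g hg.1), ⟨Set.mem_univ _, hf⟩, ?_⟩
    simp only
    rw [h1, h2, Polynomial.X_mul_divX_add, heg]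

/-- A reducible polynomial primitive in `x_l` has a factorization in which both factors involve
some other variable, so the exponent bound applies to the numbers of possible factors. -/
theorem ncard_primitive_not_irreducible_le [Finite F] [Fintype σ] [DecidableEq σ] {o l : σ}
    (hol : o ≠ l) {m : σ → ℕ} (hmax : ∀ i, i ≠ l → m i ≤ m o) (ho : 0 < m o) (hl : 0 < m l)
    (hT : 3 ≤ m o * ∏ i ∈ (Finset.univ.erase l).erase o, (m i + 1)) :
    ({f | f ∈ degreeSet F m ∧ IsVarPrimitive l f ∧ ¬ Irreducible f}.ncard : ℝ) ≤
      (Nat.card F : ℝ) ^ 4 * 2 ^ Fintype.card σ *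
        (Nat.card F : ℝ) ^ (m o * ∏ i ∈ Finset.univ.erase o, (m i + 1)) := by
  set q := Nat.card F
  have hq2 : 2 ≤ q := Finite.one_lt_card
  have hq2' : (2 : ℝ) ≤ q := by exact_mod_cast hq2
  have hq0 : (q : ℝ) ≠ 0 := by positivity
  set D := m o * ∏ i ∈ Finset.univ.erase o, (m i + 1)
  let box := Fintype.piFinset fun i => Finset.range (m i + 1)
  let G := box.filter fun a => (∃ i, i ≠ l ∧ 1 ≤ a i) ∧ (∃ i, i ≠ l ∧ 1 ≤ m i - a i) ∧
    ∏ i ∈ Finset.univ.erase l, (a i + 1) ≤ ∏ i ∈ Finset.univ.erase l, (m i - a i + 1)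
  let S : (σ → ℕ) → Set (MvPolynomial σ F) := fun a =>
    (fun g : MvPolynomial σ F × MvPolynomial σ F => g.1 * g.2) ''
      (degreeBox F a ×ˢ degreeBox F fun i => m i - a i)
  have hSfin : ∀ a, (S a).Finite := fun a =>
    ((finite_degreeBox a).prod (finite_degreeBox _)).image _
  have hsub : {f | f ∈ degreeSet F m ∧ IsVarPrimitive l f ∧ ¬ Irreducible f} ⊆
      ⋃ a ∈ G, S a := by
    rintro f ⟨hf, hprim, hirr⟩
    have hunit : ¬ IsUnit f := by
      intro h
      obtain ⟨r, -, hr⟩ := MvPolynomial.isUnit_iff_eq_C_of_isReduced.1 h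
      have := hf.2 o
      rw [hr, MvPolynomial.degreeOf_C] at this
      omega
    have key : ∀ g h : MvPolynomial σ F, f = g * h → ¬ IsUnit g → ¬ IsUnit h →
        ∏ i ∈ Finset.univ.erase l, (g.degreeOf i + 1) ≤
          ∏ i ∈ Finset.univ.erase l, (h.degreeOf i + 1) → f ∈ ⋃ a ∈ G, S a := by
      rintro g h rfl hg hh hle
      have hdeg : ∀ i, m i = g.degreeOf i + h.degreeOf i := fun i => by
        rw [← hf.2 i, MvPolynomial.degreeOf_mul_eq (left_ne_zero_of_mul hf.1)
          (right_ne_zero_of_mul hf.1)]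
      have hsubt : ∀ i, m i - g.degreeOf i = h.degreeOf i := fun i => by
        rw [hdeg i, Nat.add_sub_cancel_left]
      simp only [Set.mem_iUnion]
      refine ⟨fun i => g.degreeOf i, ?_, (g, h), ⟨fun i => le_rfl, fun i => (hsubt i).ge⟩, rfl⟩
      simp only [G, box, Finset.mem_filter, Fintype.mem_piFinset, Finset.mem_range, hsubt]
      refine ⟨fun i => ?_, hprim.exists_degreeOf_pos (dvd_mul_right _ _) hg,
        hprim.exists_degreeOf_pos (dvd_mul_left _ _) hh, hle⟩
      have := hdeg i
      omega
    simp only [irreducible_iff, not_and, not_forall, not_or] at hirr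
    obtain ⟨g, h, hgh, hg, hh⟩ := hirr hunit
    rcases le_total (∏ i ∈ Finset.univ.erase l, (g.degreeOf i + 1))
      (∏ i ∈ Finset.univ.erase l, (h.degreeOf i + 1)) with hle | hle
    · exact key g h hgh hg hh hle
    · exact key h g (hgh.trans (mul_comm g h)) hh hg hle
  have hS : ∀ a ∈ G, ((S a).ncard : ℝ) ≤ (q : ℝ) ^ (D + 4) * (q : ℝ)⁻¹ ^ ∑ i, a i := by
    intro a ha
    simp only [G, box, Finset.mem_filter, Fintype.mem_piFinset, Finset.mem_range] at ha
    obtain ⟨ham, h1, h2, h3⟩ := ha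
    have hac : ∀ i, a i + (m i - a i) = m i := fun i => by have := ham i; omega
    have hexp := exponent_le (a := a) (c := fun i => m i - a i) hol (by simpa only [hac])
      h1 h2 (by simpa only [hac]) h3 (by simpa only [hac])
    simp only [hac] at hexp
    have hcard : (S a).ncard ≤ q ^ (∏ i, (a i + 1) + ∏ i, (m i - a i + 1)) := by
      refine (Set.ncard_image_le ((finite_degreeBox a).prod (finite_degreeBox _))).trans ?_
      rw [Set.ncard_prod, pow_add]
      exact Nat.mul_le_mul (ncard_degreeBox_le a) (ncard_degreeBox_le _)
    rw [inv_pow, ← div_eq_mul_inv, le_div_iff₀ (by positivity)]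
    calc ((S a).ncard : ℝ) * (q : ℝ) ^ ∑ i, a i
        ≤ (q : ℝ) ^ (∏ i, (a i + 1) + ∏ i, (m i - a i + 1)) * (q : ℝ) ^ ∑ i, a i := by
          gcongr
          exact_mod_cast hcard
      _ ≤ (q : ℝ) ^ (D + 4) := by
          rw [← pow_add]
          exact pow_le_pow_right₀ (by linarith) hexp
  have hfin : (⋃ a ∈ G, S a).Finite := G.finite_toSet.biUnion fun a _ => hSfin a
  calc ({f | f ∈ degreeSet F m ∧ IsVarPrimitive l f ∧ ¬ Irreducible f}.ncard : ℝ)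
      ≤ ((⋃ a ∈ G, S a).ncard : ℝ) := by exact_mod_cast Set.ncard_le_ncard hsub hfin
    _ ≤ ∑ a ∈ G, ((S a).ncard : ℝ) := by exact_mod_cast Finset.set_ncard_biUnion_le G S
    _ ≤ ∑ a ∈ G, (q : ℝ) ^ (D + 4) * (q : ℝ)⁻¹ ^ ∑ i, a i := Finset.sum_le_sum hS
    _ ≤ ∑ a ∈ box, (q : ℝ) ^ (D + 4) * (q : ℝ)⁻¹ ^ ∑ i, a i :=
        Finset.sum_le_sum_of_subset_of_nonneg (Finset.filter_subset _ _)
          fun _ _ _ => by positivity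
    _ ≤ (q : ℝ) ^ (D + 4) * 2 ^ Fintype.card σ := by
        rw [← Finset.mul_sum]
        gcongr
        exact sum_inv_pow_le hq2' m
    _ = (q : ℝ) ^ 4 * 2 ^ Fintype.card σ * (q : ℝ) ^ D := by ring

end Counting

/-! ### Passing to classes of polynomials -/

/-- A class of nonzero polynomials has as many members as `F` has units. -/
theorem ncard_eq_card_units_mul {F : Type*} [Field F] {k : ℕ}
    {S : Set (MvPolynomial (Fin k) F)} (h0 : ∀ f ∈ S, f ≠ 0)
    (hS : ∀ f ∈ S, ∀ c : Fˣ, MvPolynomial.C (c : F) * f ∈ S) :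
    S.ncard = Nat.card Fˣ * (NormalizedPoly.mk '' S).ncard := by
  have hout : ∀ x : NormalizedPoly F k, NormalizedPoly.mk (Quotient.out x) = x :=
    fun x => Quotient.out_eq' x
  have hmem : ∀ x ∈ NormalizedPoly.mk '' S, Quotient.out x ∈ S := by
    rintro x ⟨f, hf, hx⟩
    obtain ⟨c, hc⟩ := (NormalizedPoly.mk_eq_mk_iff _ _).1 ((hout x).trans hx.symm)
    rw [hc]
    exact hS f hf c
  rw [← Set.ncard_univ, ← Set.ncard_prod]
  symm
  refine Set.ncard_congr (fun (a : Fˣ × NormalizedPoly F k) _ =>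
    MvPolynomial.C (a.1 : F) * Quotient.out a.2) ?_ ?_ ?_
  · rintro ⟨c, x⟩ ⟨-, hx⟩
    exact hS _ (hmem x hx) c
  · rintro ⟨c, x⟩ ⟨d, y⟩ ⟨-, hx⟩ ⟨-, hy⟩ h
    have hxy : x = y := by
      have e : ∀ (c : Fˣ) (z : NormalizedPoly F k),
          NormalizedPoly.mk (MvPolynomial.C (c : F) * Quotient.out z) = z := fun c z =>
        ((NormalizedPoly.mk_eq_mk_iff _ _).2 ⟨c, rfl⟩).trans (hout z)
      rw [← e c x, ← e d y]
      exact congrArg _ h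
    subst hxy
    have := MvPolynomial.C_injective _ _ (mul_right_cancel₀ (h0 _ (hmem x hx)) h)
    exact Prod.ext (Units.ext this) rfl
  · intro f hf
    have hx : NormalizedPoly.mk f ∈ NormalizedPoly.mk '' S := ⟨f, hf, rfl⟩
    obtain ⟨c, hc⟩ := (NormalizedPoly.mk_eq_mk_iff f (Quotient.out (NormalizedPoly.mk f))).1
      (hout _).symm
    exact ⟨(c, NormalizedPoly.mk f), ⟨Set.mem_univ _, hx⟩, hc.symm⟩

theorem C_units_mul_mem_degreeSet {F : Type*} [Field F] {σ : Type*} {m : σ → ℕ}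
    {f : MvPolynomial σ F} (hf : f ∈ degreeSet F m) (c : Fˣ) :
    MvPolynomial.C (c : F) * f ∈ degreeSet F m := by
  refine ⟨mul_ne_zero (by simp) hf.1, fun i => ?_⟩
  rw [MvPolynomial.degreeOf_C_mul i _ (mem_nonZeroDivisors_of_ne_zero c.ne_zero), hf.2 i]

theorem ncard_degreeSet {F : Type*} [Field F] {k : ℕ} (m : Fin k → ℕ) :
    (degreeSet F m).ncard = Nat.card Fˣ * numNormalized F m := by
  rw [ncard_eq_card_units_mul (fun f hf => hf.1) fun f hf => C_units_mul_mem_degreeSet hf,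
    numNormalized]
  congr 2
  ext x
  simp only [degreeSet, normalizedOfDegree, vectorDegree, funext_iff, Set.mem_image,
    Set.mem_ofPred_eq, and_assoc]

theorem ncard_irreducible_degreeSet {F : Type*} [Field F] {k : ℕ} (m : Fin k → ℕ) :
    {f | f ∈ degreeSet F m ∧ Irreducible f}.ncard = Nat.card Fˣ * numIrreducible F m := by
  have hC : ∀ c : Fˣ, IsUnit (MvPolynomial.C (σ := Fin k) (c : F)) := fun c => c.isUnit.map _
  rw [ncard_eq_card_units_mul (S := {f | f ∈ degreeSet F m ∧ Irreducible f})
    (fun f hf => hf.1.1) (fun f hf c =>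
      ⟨C_units_mul_mem_degreeSet hf.1 c, (irreducible_isUnit_mul (hC c)).2 hf.2⟩),
    numIrreducible]
  congr 2
  ext x
  simp only [degreeSet, irreducibleOfDegree, vectorDegree, funext_iff, Set.mem_image,
    Set.mem_ofPred_eq]
  exact ⟨fun ⟨f, ⟨⟨_, hm⟩, hf⟩, hx⟩ => ⟨f, hf, hm, hx⟩,
    fun ⟨f, hf, hm, hx⟩ => ⟨f, ⟨⟨hf.ne_zero, hm⟩, hf⟩, hx⟩⟩

/-- The extremal product `T = m_1 (m_2 + 1) ⋯ (m_{k-1} + 1)` is at least `3`; for `k ≤ 3` this is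
what the conditions on `m_1` are for. -/
theorem three_le_mul_prod_erase {k : ℕ} (hk : 2 ≤ k) {m : Fin k → ℕ} (hm : ∀ i, 0 < m i)
    {o l : Fin k} (hol : o ≠ l) (h2 : k = 2 → 3 ≤ m o) (h3 : k = 3 → 2 ≤ m o) :
    3 ≤ m o * ∏ i ∈ ((Finset.univ : Finset (Fin k)).erase l).erase o, (m i + 1) := by
  have hc : ((Finset.univ.erase l).erase o).card = k - 2 := by
    rw [Finset.card_erase_of_mem (by simp [hol]), Finset.card_erase_of_mem (Finset.mem_univ _),
      Finset.card_univ, Fintype.card_fin, Nat.sub_sub]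
  have h := Finset.pow_card_le_prod ((Finset.univ.erase l).erase o) (fun i => m i + 1) 2
    fun i _ => Nat.succ_le_succ (hm i)
  rw [hc] at h
  have h0 := hm o
  rcases (show k = 2 ∨ k = 3 ∨ 4 ≤ k by omega) with hk2 | hk3 | hk4
  · subst hk2
    exact (Nat.mul_le_mul (h2 rfl) h).trans' (by norm_num)
  · subst hk3
    exact (Nat.mul_le_mul (h3 rfl) h).trans' (by norm_num)
  · have : 2 ^ 2 ≤ 2 ^ (k - 2) := Nat.pow_le_pow_right two_pos (by omega)
    nlinarith

theorem theorem5p3 (F : Type*) [Field F] [Finite F] (k : ℕ) (hk : 2 ≤ k) :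
    ∃ C : ℝ, 0 < C ∧ ∀ m : Fin k → ℕ,
      (∀ i, 0 < m i) →
      (∀ i : Fin k, (i : ℕ) + 1 < k → m i ≤ m ⟨0, by omega⟩) →
      (k = 2 → 3 ≤ m ⟨0, by omega⟩) →
      (k = 3 → 2 ≤ m ⟨0, by omega⟩) →
      |(numIrreducible F m : ℝ) -
          ((numNormalized F m : ℝ) -
            (Nat.card F : ℝ) *
              (numNormalized F
                (Function.update m ⟨k - 1, by omega⟩ (m ⟨k - 1, by omega⟩ - 1)) : ℝ))|
        ≤ C * (Nat.card F : ℝ) ^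
            (m ⟨0, by omega⟩ *
              ∏ i ∈ (Finset.univ : Finset (Fin k)).erase ⟨0, by omega⟩, (m i + 1)) := by
  obtain ⟨o, ho⟩ : ∃ o : Fin k, o = ⟨0, by omega⟩ := ⟨_, rfl⟩
  obtain ⟨l, hl⟩ : ∃ l : Fin k, l = ⟨k - 1, by omega⟩ := ⟨_, rfl⟩
  have hol : o ≠ l := by rw [ho, hl, ne_eq, Fin.mk.injEq]; omega
  have hq : 0 < Nat.card F := Nat.card_pos
  refine ⟨(Nat.card F : ℝ) ^ 4 * 2 ^ Fintype.card (Fin k), by positivity, ?_⟩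
  intro m hm hmax h2 h3
  rw [← ho] at hmax h2 h3
  rw [← ho, ← hl]
  have hT := three_le_mul_prod_erase hk hm hol h2 h3
  have hbound := ncard_primitive_not_irreducible_le (F := F) hol
    (fun i hi => hmax i (by
      rw [hl, ne_eq, Fin.ext_iff] at hi
      have := i.isLt
      simp only at hi
      omega)) (hm o) (hm l) hT
  refine le_trans ?_ hbound
  set R := {f | f ∈ degreeSet F m ∧ IsVarPrimitive l f ∧ ¬ Irreducible f} with hR
  have hnon := ncard_not_isVarPrimitive (F := F) l m (hm l)
  have hfin := finite_degreeSet (F := F) m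
  have hsplit : (degreeSet F m).ncard = {f | f ∈ degreeSet F m ∧ Irreducible f}.ncard +
      R.ncard + {f | f ∈ degreeSet F m ∧ ¬ IsVarPrimitive l f}.ncard := by
    have hirr : ∀ f ∈ degreeSet F m, Irreducible f → IsVarPrimitive l f := fun f hf h =>
      h.isVarPrimitive hol (by rw [hf.2]; exact hm o)
    rw [← Set.ncard_union_eq _ (hfin.subset fun f hf => hf.1) (hfin.subset fun f hf => hf.1),
      ← Set.ncard_union_eq _ _ (hfin.subset fun f hf => hf.1)]
    · congr 1
      ext f
      have := hirr f
      simp only [hR, Set.mem_union, Set.mem_ofPred_eq]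
      tauto
    · rw [Set.disjoint_left]
      rintro f (⟨hf, h⟩ | ⟨hf, h, -⟩) ⟨-, h'⟩
      · exact h' (hirr f hf h)
      · exact h' h
    · exact (hfin.subset fun f hf => hf.1).union (hfin.subset fun f hf => hf.1)
    · rw [Set.disjoint_left]
      rintro f ⟨hf, h⟩ ⟨-, -, h'⟩
      exact h' h
  rw [hnon, ncard_degreeSet, ncard_degreeSet, ncard_irreducible_degreeSet] at hsplit
  have hsplit' := congrArg (Nat.cast (R := ℝ)) hsplit
  push_cast at hsplit'
  have hu : (1 : ℝ) ≤ Nat.card Fˣ := by exact_mod_cast (Nat.card_pos (α := Fˣ))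
  generalize (Nat.card Fˣ : ℝ) = u at hsplit' hu
  -- up to the factor `u`, the left-hand side is `-|R|`
  have heq : u * ((numIrreducible F m : ℝ) - ((numNormalized F m : ℝ) - (Nat.card F : ℝ) *
      (numNormalized F (Function.update m l (m l - 1)) : ℝ))) = -R.ncard := by
    linear_combination -hsplit'
  have habs := congrArg abs heq
  rw [abs_mul, abs_neg, Nat.abs_cast, abs_of_pos (by linarith)] at habs
  rw [← habs]
  exact le_mul_of_one_le_left (abs_nonneg _) hu
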